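/- Let $F=\mathbb F_q$ be a finite field, let $\mathbf Q=(q_{ij})\in F^{2\times 2}$, and let $P_1,P_2$ be probability distributions on $F$. Write $H(\zeta_k)$ for the Shannon entropy of $P_k$; all logarithms are to base $2$. Assume $H(\zeta_k)<\log q$ for $k=1,2$. The finite-field Network-Coded cognitive interference channel (CIC) is the following communication problem. Messages $w_k\in F^{r_k}$ ($k=1,2$) are independent and uniformly distributed; the shorter one is zero-padded to the common length $\max\{r_1,r_2\}$. Transmitter 1 knows $(w_1,w_2)$ and sends $x_1\in F^n$, a function of $(w_1,w_2)$; transmitter 2 knows only $w_1\oplus w_2$ (the sum of the padded messages) and sends $x_2\in F^n$, a function of $w_1\oplus w_2$. Receiver $k$ observes $y_k=q_{k1}x_1+q_{k2}x_2+\zeta_k\in F^n$, where the entries of $\zeta_k$ are i.i.d. with law $P_k$ and independent of the messages, and forms an estimate $\hat w_k$ of $w_k$ from $y_k$. The encoders and decoders may depend on $\mathbf Q$ and on $P_1,P_2$. A pair $(R_1,R_2)$ with $R_1,R_2\ge 0$ is achievable if there are codes of every block length $n$, with message lengths $r_1(n),r_2(n)$, such that $\liminf_{n\to\infty}\frac{r_k(n)}{n}\log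 q\ge R_k$ and $\lim_{n\to\infty}\mathbb P(\hat w_k\ne w_k)=0$ for both $k=1,2$. The sum capacity $C_{\mathrm{sum}}$ is the supremum of $R_1+R_2$ over all achievable pairs. If $q_{11}=0$ or $q_{21}=0$, then $C_{\mathrm{sum}}$ is finite (it is the least upper bound of a nonempty bounded set) and $$C_{\mathrm{sum}}\;\le\;\log q-\min\{H(\zeta_1),H(\zeta_2)\}\;<\;2\log q-H(\zeta_1)-H(\zeta_2).$$ Consequently, the sum capacity is strictly less than $C_1+C_2$, where $C_k=\max_{P_X} I(X;X+\zeta_k)=\log q-H(\zeta_k)$ is the capacity of the interference-free additive noise channel $y=x+\zeta_k$ over $F$. -/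

import Mathlib

namespace NCCIC

/-- Shannon entropy, in bits, of a law `P` on a finite alphabet. -/
noncomputable def entropy {A : Type*} [Fintype A] (P : PMF A) : ℝ :=
  -∑ a, (P a).toReal * Real.logb 2 (P a).toReal

/-- Mutual information `I(X; X + ζ)`, in bits, of the additive noise channel with noise law `P`
and input law `p`; the output law is `y ↦ ∑ x', p x' * P (y - x')`. -/
noncomputable def mutualInfo {F : Type*} [Field F] [Fintype F] (P p : PMF F) : ℝ :=
  ∑ x, ∑ y, (p x).toReal * (P (y - x)).toReal *
    Real.logb 2 ((P (y - x)).toReal / ∑ x', (p x').toReal * (P (y - x')).toReal)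

/-- Shannon capacity `max_p I(X; X + ζ)` of the interference-free additive noise channel
`y = x + ζ`, where `ζ` has law `P`. -/
noncomputable def additiveNoiseCapacity {F : Type*} [Field F] [Fintype F] (P : PMF F) : ℝ :=
  sSup (Set.range fun p : PMF F => mutualInfo P p)

/-- A pair of messages: user `k` has `r k` symbols of `F`. -/
abbrev Messages (F : Type*) (r : Fin 2 → ℕ) : Type _ := (k : Fin 2) → Fin (r k) → F

/-- Zero-padding of a message to length `m`. -/
def zeroPad {F : Type*} [Zero F] {l : ℕ} (m : ℕ) (w : Fin l → F) : Fin m → F :=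
  fun i => if h : (i : ℕ) < l then w ⟨i, h⟩ else 0

/-- The mixed message `w₁ ⊕ w₂`, after zero-padding to the common length `max r₁ r₂`. -/
def mixed {F : Type*} [Field F] {r : Fin 2 → ℕ} (w : Messages F r) :
    Fin (max (r 0) (r 1)) → F :=
  zeroPad (max (r 0) (r 1)) (w 0) + zeroPad (max (r 0) (r 1)) (w 1)

/-- A block code of length `n`. Transmitter 1 sees both messages, transmitter 2 sees only the
mixed message, receiver `k` estimates message `k` from its own channel output. Users 1 and 2
are indexed by `0` and `1`. -/
structure Code (F : Type*) (n : ℕ) (r : Fin 2 → ℕ) where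
  enc₁ : Messages F r → Fin n → F
  enc₂ : (Fin (max (r 0) (r 1)) → F) → Fin n → F
  dec : (k : Fin 2) → (Fin n → F) → Fin (r k) → F

/-- Channel output at receiver `k`, for messages `w` and noise block `z` at that receiver. -/
def Code.output {F : Type*} [Field F] {n : ℕ} {r : Fin 2 → ℕ} (c : Code F n r)
    (Q : Matrix (Fin 2) (Fin 2) F) (k : Fin 2) (w : Messages F r) (z : Fin n → F) : Fin n → F :=
  fun t => Q k 0 * c.enc₁ w t + Q k 1 * c.enc₂ (mixed w) t + z t

/-- Average probability that receiver `k` errs: the messages are independent and uniform, and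
the noise block at receiver `k` is i.i.d. with law `P k`, independent of the messages. -/
noncomputable def Code.errorProb {F : Type*} [Field F] [Fintype F] [DecidableEq F]
    {n : ℕ} {r : Fin 2 → ℕ} (c : Code F n r)
    (Q : Matrix (Fin 2) (Fin 2) F) (P : Fin 2 → PMF F) (k : Fin 2) : ℝ :=
  (∑ w : Messages F r, ∑ z : Fin n → F,
    (∏ t, (P k (z t)).toReal) * (if c.dec k (c.output Q k w z) ≠ w k then 1 else 0)) /
  (Fintype.card (Messages F r) : ℝ)

/-- `(R 0, R 1)` (in bits per channel use) is achievable: there are codes, one for each block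
length `n`, whose rates `(r k / n) log q` are asymptotically at least `R k` and whose error
probabilities tend to zero at both receivers. -/
def Achievable {F : Type*} [Field F] [Fintype F] [DecidableEq F]
    (Q : Matrix (Fin 2) (Fin 2) F) (P : Fin 2 → PMF F) (R : Fin 2 → ℝ) : Prop :=
  (∀ k, 0 ≤ R k) ∧
  ∃ (r : ℕ → Fin 2 → ℕ) (c : (n : ℕ) → Code F n (r n)),
    (∀ k, ∀ ε > (0 : ℝ), ∀ᶠ n in Filter.atTop,
      R k - ε ≤ (r n k : ℝ) / (n : ℝ) * Real.logb 2 (Fintype.card F)) ∧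
    ∀ k, Filter.Tendsto (fun n => (c n).errorProb Q P k) Filter.atTop (nhds 0)

/-- The set of achievable sum rates. -/
def achievableSumRates {F : Type*} [Field F] [Fintype F] [DecidableEq F]
    (Q : Matrix (Fin 2) (Fin 2) F) (P : Fin 2 → PMF F) : Set ℝ :=
  {s | ∃ R : Fin 2 → ℝ, Achievable Q P R ∧ s = R 0 + R 1}

/-- The sum capacity: the supremum of the achievable sum rates. -/
noncomputable def sumCapacity {F : Type*} [Field F] [Fintype F] [DecidableEq F]
    (Q : Matrix (Fin 2) (Fin 2) F) (P : Fin 2 → PMF F) : ℝ :=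
  sSup (achievableSumRates Q P)

end NCCIC

/-! If `Q k 0 = 0`, receiver `k` sees only a noisy function of `w₁ ⊕ w₂`. When both messages are
nonempty, adding `(e, -e)` to `(w₁, w₂)` leaves the mixed message unchanged but alters `w k`, so the
error is at least 1/2 (`half_le_errorProb`). Vanishing error thus forces one message to be empty for
all large `n`, and the other obeys the single-user converse `log q - H(ζ_j)` (`eventually_rate_le`).
That converse avoids Fano: a correct decoding is paid for either by an unusually likely noise block,
which is exponentially rare by Chernoff, or by a volume count over outputs (`one_sub_errorProb_le`).
-/

namespace NCCIC

/-! ### Entropy and Gibbs' inequality. -/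

section Entropy

variable {A : Type*} [Fintype A]

theorem pmf_sum_toReal (P : PMF A) : ∑ a, (P a).toReal = 1 := by
  have h : ∑ a, P a = 1 := by rw [← P.tsum_coe, tsum_fintype]
  rw [← ENNReal.toReal_sum fun a _ => P.apply_ne_top a, h, ENNReal.toReal_one]

/-- Gibbs' inequality against the uniform law. -/
theorem neg_sum_mul_logb_le_logb_card [Nonempty A] (f : A → ℝ) (hf : ∀ a, 0 ≤ f a)
    (hs : ∑ a, f a = 1) :
    -∑ a, f a * Real.logb 2 (f a) ≤ Real.logb 2 (Fintype.card A) := by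
  have hq : (0 : ℝ) < Fintype.card A := by exact_mod_cast Fintype.card_pos
  have hl : 0 < Real.log 2 := Real.log_pos one_lt_two
  have key : ∀ a, -(f a * Real.log (f a)) - f a * Real.log (Fintype.card A) ≤
      1 / (Fintype.card A : ℝ) - f a := by
    intro a
    rcases (hf a).eq_or_lt with h | h
    · rw [← h]; simp
    · have h1 := Real.log_le_sub_one_of_pos (x := 1 / (Fintype.card A * f a)) (by positivity)
      rw [one_div, Real.log_inv, Real.log_mul hq.ne' h.ne'] at h1
      have h2 := mul_le_mul_of_nonneg_left h1 h.le
      have h3 : f a * ((Fintype.card A * f a)⁻¹ - 1) = 1 / (Fintype.card A : ℝ) - f a := by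
        field_simp
      linarith
  have h := Finset.sum_le_sum fun a (_ : a ∈ Finset.univ) => key a
  rw [Finset.sum_sub_distrib, Finset.sum_sub_distrib, ← Finset.sum_mul, hs, Finset.sum_const,
    Finset.card_univ, nsmul_eq_mul, mul_one_div_cancel hq.ne', Finset.sum_neg_distrib] at h
  simp only [Real.logb, ← mul_div_assoc]
  rw [← Finset.sum_div, ← neg_div]
  exact div_le_div_of_nonneg_right (by linarith) hl.le

end Entropy

/-! ### Capacity of the additive noise channel. -/

section Capacity

variable {F : Type*} [Field F] [Fintype F]

theorem sum_toReal_sub_left (P : PMF F) (x : F) : ∑ y, (P (y - x)).toReal = 1 := by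
  rw [← pmf_sum_toReal P]
  exact (Equiv.subRight x).sum_comp fun a => (P a).toReal

theorem sum_toReal_sub_right (P : PMF F) (y : F) : ∑ x, (P (y - x)).toReal = 1 := by
  rw [← pmf_sum_toReal P]
  exact (Equiv.subLeft y).sum_comp fun a => (P a).toReal

/-- `I(X; X + ζ) = H(X + ζ) - H(ζ)`. -/
theorem mutualInfo_eq (P p : PMF F) :
    mutualInfo P p =
      (-∑ y, (∑ x, (p x).toReal * (P (y - x)).toReal) *
        Real.logb 2 (∑ x, (p x).toReal * (P (y - x)).toReal)) - entropy P := by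
  set o : F → ℝ := fun y => ∑ x, (p x).toReal * (P (y - x)).toReal with ho
  have hterm : ∀ x y, (p x).toReal * (P (y - x)).toReal *
      Real.logb 2 ((P (y - x)).toReal / o y) =
      (p x).toReal * ((P (y - x)).toReal * Real.logb 2 (P (y - x)).toReal) -
        (p x).toReal * (P (y - x)).toReal * Real.logb 2 (o y) := by
    intro x y
    -- The logarithm of the quotient splits only for nonzero arguments; null terms vanish on both
    -- sides.
    by_cases h : (p x).toReal * (P (y - x)).toReal = 0
    · rw [h, ← mul_assoc, h]; ring
    · have hP : (P (y - x)).toReal ≠ 0 := right_ne_zero_of_mul h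
      have hle : (p x).toReal * (P (y - x)).toReal ≤ o y :=
        Finset.single_le_sum (f := fun x => (p x).toReal * (P (y - x)).toReal)
          (fun _ _ => by positivity) (Finset.mem_univ x)
      have hpos : 0 < (p x).toReal * (P (y - x)).toReal :=
        lt_of_le_of_ne (by positivity) (Ne.symm h)
      rw [Real.logb_div hP (hpos.trans_le hle).ne']; ring
  have h1 : ∑ x, ∑ y, (p x).toReal * ((P (y - x)).toReal * Real.logb 2 (P (y - x)).toReal) =
      -entropy P := by
    have hx : ∀ x, ∑ y, (P (y - x)).toReal * Real.logb 2 (P (y - x)).toReal = -entropy P :=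
      fun x => by
        rw [entropy, neg_neg]
        exact (Equiv.subRight x).sum_comp fun a => (P a).toReal * Real.logb 2 (P a).toReal
    simp_rw [← Finset.mul_sum, hx]
    rw [← Finset.sum_mul, pmf_sum_toReal, one_mul]
  have h2 : ∑ x, ∑ y, (p x).toReal * (P (y - x)).toReal * Real.logb 2 (o y) =
      ∑ y, o y * Real.logb 2 (o y) := by
    rw [Finset.sum_comm]
    exact Finset.sum_congr rfl fun y _ => by rw [← Finset.sum_mul]
  calc mutualInfo P p = ∑ x, ∑ y, (p x).toReal * (P (y - x)).toReal *
      Real.logb 2 ((P (y - x)).toReal / o y) := rfl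
    _ = -entropy P - ∑ y, o y * Real.logb 2 (o y) := by
      simp_rw [hterm, Finset.sum_sub_distrib]
      rw [h1, h2]
    _ = _ := by ring

/-- Uniform input makes the output uniform, which attains the Gibbs bound on the output entropy. -/
theorem additiveNoiseCapacity_eq (P : PMF F) :
    additiveNoiseCapacity P = Real.logb 2 (Fintype.card F) - entropy P := by
  have hq : (Fintype.card F : ℝ) ≠ 0 := by exact_mod_cast Fintype.card_ne_zero
  refine IsGreatest.csSup_eq ⟨⟨PMF.uniformOfFintype F, ?_⟩, ?_⟩
  · have h : ∀ y, ∑ x, ((PMF.uniformOfFintype F) x).toReal * (P (y - x)).toReal =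
        (Fintype.card F : ℝ)⁻¹ := by
      intro y
      simp only [PMF.uniformOfFintype_apply, ENNReal.toReal_inv, ENNReal.toReal_natCast]
      rw [← Finset.mul_sum, sum_toReal_sub_right, mul_one]
    simp only [mutualInfo_eq, h, Finset.sum_const, Finset.card_univ, nsmul_eq_mul]
    rw [Real.logb_inv, ← mul_assoc, mul_inv_cancel₀ hq]
    ring
  · rintro _ ⟨p, rfl⟩
    simp only [mutualInfo_eq]
    refine sub_le_sub_right (neg_sum_mul_logb_le_logb_card _ (fun y => ?_) ?_) _
    · exact Finset.sum_nonneg fun _ _ => by positivity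
    · rw [Finset.sum_comm]
      simp_rw [← Finset.mul_sum, sum_toReal_sub_left, mul_one]
      exact pmf_sum_toReal p

end Capacity

/-! ### Large deviations of the noise likelihood. -/

section Tail

variable {A : Type*} [Fintype A]

theorem sum_prod_toReal (P : PMF A) (n : ℕ) : ∑ z : Fin n → A, ∏ t, (P (z t)).toReal = 1 := by
  classical
  rw [← Fintype.sum_pow fun a => (P a).toReal, pmf_sum_toReal, one_pow]

/-- At `s = 0` the sum is 1 and its derivative is `E[log P] + H - δ = -δ`, so it drops below 1 for
small `s > 0`. -/
theorem exists_exp_tilt_lt_one (P : PMF A) {δ : ℝ} (hδ : 0 < δ) :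
    ∃ s > (0 : ℝ), ∑ a, (P a).toReal *
      Real.exp (s * (Real.logb 2 (P a).toReal + (entropy P - δ))) < 1 := by
  set g : ℝ → ℝ := fun s => ∑ a, (P a).toReal *
    Real.exp (s * (Real.logb 2 (P a).toReal + (entropy P - δ))) with hg
  have hder : HasDerivAt g (-δ) 0 := by
    have h : HasDerivAt g (∑ a, (P a).toReal *
        (Real.exp (0 * (Real.logb 2 (P a).toReal + (entropy P - δ))) *
          (1 * (Real.logb 2 (P a).toReal + (entropy P - δ))))) 0 :=
      HasDerivAt.fun_sum fun a _ =>
        (((hasDerivAt_id (0 : ℝ)).mul_const _).exp).const_mul _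
    convert h using 1
    simp only [zero_mul, Real.exp_zero, one_mul]
    simp only [mul_add, Finset.sum_add_distrib]
    rw [← Finset.sum_mul, pmf_sum_toReal, entropy]
    ring
  have h0 : g 0 = 1 := by simp [hg, pmf_sum_toReal]
  have hev : ∀ᶠ s in nhdsWithin (0 : ℝ) (Set.Ioi 0), slope g 0 s < 0 :=
    ((hasDerivAt_iff_tendsto_slope.mp hder).mono_left
      (nhdsWithin_mono _ fun _ h => ne_of_gt h)).eventually_lt_const (by linarith)
  obtain ⟨s, hs, hpos⟩ := (hev.and self_mem_nhdsWithin).exists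
  refine ⟨s, hpos, ?_⟩
  rw [slope_def_field, h0, sub_zero, div_lt_iff₀ hpos, zero_mul] at hs
  exact sub_neg.mp hs

/-- Chernoff bound for the atypically likely blocks of an i.i.d. source. -/
theorem exists_tail_le_pow (P : PMF A) {δ : ℝ} (hδ : 0 < δ) :
    ∃ ρ : ℝ, 0 ≤ ρ ∧ ρ < 1 ∧ ∀ n : ℕ,
      (∑ z : Fin n → A, if (2 : ℝ) ^ (-(n * (entropy P - δ))) < ∏ t, (P (z t)).toReal
        then ∏ t, (P (z t)).toReal else 0) ≤ ρ ^ n := by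
  classical
  obtain ⟨s, hs, hlt⟩ := exists_exp_tilt_lt_one P hδ
  -- `ρ` is the tilted sum; its `n`-th power expands into a sum over blocks.
  refine ⟨_, Finset.sum_nonneg fun a _ => by positivity, hlt, fun n => ?_⟩
  rw [Fintype.sum_pow]
  refine Finset.sum_le_sum fun z _ => ?_
  rw [Finset.prod_mul_distrib, ← Real.exp_sum, ← Finset.mul_sum]
  have hnn : 0 ≤ ∏ t, (P (z t)).toReal := Finset.prod_nonneg fun _ _ => by positivity
  split_ifs with h
  · refine le_mul_of_one_le_right hnn (Real.one_le_exp (mul_nonneg hs.le ?_))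
    have hpos : 0 < ∏ t, (P (z t)).toReal := (Real.rpow_pos_of_pos two_pos _).trans h
    have hl := Real.logb_lt_logb one_lt_two (Real.rpow_pos_of_pos two_pos _) h
    rw [Real.logb_rpow two_pos (by norm_num),
      Real.logb_prod _ _ fun t _ => (Finset.prod_ne_zero_iff.mp hpos.ne') t (Finset.mem_univ t)]
      at hl
    rw [Finset.sum_add_distrib, Finset.sum_const, Finset.card_univ, Fintype.card_fin,
      nsmul_eq_mul]
    linarith
  · exact mul_nonneg hnn (Real.exp_pos _).le

end Tail

/-! ### Error bounds for a fixed code. -/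

section Codes

variable {F : Type*} [Field F]

theorem mixed_add {r : Fin 2 → ℕ} (w v : Messages F r) : mixed (w + v) = mixed w + mixed v := by
  funext i
  simp only [mixed, zeroPad, Pi.add_apply]
  split_ifs <;> ring

/-- A nonzero perturbation of both messages that the mixed message does not see. -/
def hiddenShift (F : Type*) [Field F] (r : Fin 2 → ℕ) : Messages F r :=
  fun k i => if (i : ℕ) = 0 then (if k = 0 then 1 else -1) else 0

/-- The entries `1` and `-1` cancel at coordinate 0, which exists in both messages only if neither
is empty. -/
theorem mixed_hiddenShift {r : Fin 2 → ℕ} (h : ∀ k, 0 < r k) : mixed (hiddenShift F r) = 0 := by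
  funext i
  simp only [mixed, zeroPad, hiddenShift, Pi.add_apply, Pi.zero_apply]
  rcases Nat.eq_zero_or_pos (i : ℕ) with hi | hi
  · simp [hi, h 0, h 1]
  · simp [hi.ne']

theorem hiddenShift_ne_zero {r : Fin 2 → ℕ} (k : Fin 2) (h : 0 < r k) :
    hiddenShift F r k ≠ 0 := by
  intro h0
  have := congrFun h0 ⟨0, h⟩
  simp only [hiddenShift, if_true, Pi.zero_apply] at this
  split_ifs at this
  · exact one_ne_zero this
  · exact neg_ne_zero.mpr one_ne_zero this

variable [Fintype F] [DecidableEq F] {n : ℕ} {r : Fin 2 → ℕ}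

theorem card_messages_pos (F : Type*) [Field F] [Fintype F] (r : Fin 2 → ℕ) :
    (0 : ℝ) < Fintype.card (Messages F r) := by
  exact_mod_cast Fintype.card_pos

/-- A receiver that sees only the mixed message cannot decode when both messages are nonempty. -/
theorem half_le_errorProb (c : Code F n r) (Q : Matrix (Fin 2) (Fin 2) F) (P : Fin 2 → PMF F)
    (k : Fin 2) (hQ : Q k 0 = 0) (hr : ∀ j, 0 < r j) : 1 / 2 ≤ c.errorProb Q P k := by
  rw [Code.errorProb, le_div_iff₀ (card_messages_pos F r), Finset.sum_comm]
  have hz : ∀ z : Fin n → F, 1 / 2 * (Fintype.card (Messages F r) : ℝ) ≤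
      ∑ w : Messages F r, if c.dec k (c.output Q k w z) ≠ w k then (1 : ℝ) else 0 := by
    intro z
    set f : Messages F r → ℝ := fun w =>
      if c.dec k (c.output Q k w z) ≠ w k then (1 : ℝ) else 0 with hf
    have hshift : ∑ w, f (w + hiddenShift F r) = ∑ w, f w :=
      Equiv.sum_comp (Equiv.addRight (hiddenShift F r)) f
    -- Both message pairs give the same output but differ at `k`, so at least one is misdecoded.
    have hpair : ∀ w, 1 ≤ f w + f (w + hiddenShift F r) := by
      intro w
      have ho : c.output Q k (w + hiddenShift F r) z = c.output Q k w z := by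
        funext t
        simp only [Code.output, hQ, zero_mul, mixed_add, mixed_hiddenShift hr, add_zero]
      simp only [hf, ho]
      by_cases h1 : c.dec k (c.output Q k w z) = w k
      · have h2 : c.dec k (c.output Q k w z) ≠ (w + hiddenShift F r) k := by
          rw [h1, Pi.add_apply]
          exact fun h => hiddenShift_ne_zero k (hr k) (left_eq_add.mp h)
        rw [if_pos h2]; split_ifs <;> norm_num
      · rw [if_pos h1]; split_ifs <;> norm_num
    have hsum := Finset.sum_le_sum fun w (_ : w ∈ Finset.univ) => hpair w
    rw [Finset.sum_add_distrib, hshift, Finset.sum_const, Finset.card_univ, nsmul_eq_mul,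
      mul_one] at hsum
    linarith
  calc 1 / 2 * (Fintype.card (Messages F r) : ℝ)
      = ∑ z : Fin n → F, (∏ t, (P k (z t)).toReal) *
          (1 / 2 * (Fintype.card (Messages F r) : ℝ)) := by
        rw [← Finset.sum_mul, sum_prod_toReal, one_mul]
    _ ≤ ∑ z : Fin n → F, (∏ t, (P k (z t)).toReal) *
          ∑ w : Messages F r, if c.dec k (c.output Q k w z) ≠ w k then (1 : ℝ) else 0 :=
        Finset.sum_le_sum fun z _ => mul_le_mul_of_nonneg_left (hz z)
          (Finset.prod_nonneg fun _ _ => by positivity)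
    _ = _ := Finset.sum_congr rfl fun z _ => by rw [Finset.mul_sum]

theorem card_messages_fiber (k : Fin 2) (a : Fin (r k) → F) :
    ((Finset.univ.filter fun w : Messages F r => w k = a).card : ℝ) =
      Fintype.card (Messages F r) / (Fintype.card F : ℝ) ^ r k := by
  have hq : (0 : ℝ) < Fintype.card F := by exact_mod_cast Fintype.card_pos
  have hsum : ∑ b : Fin (r k) → F,
      ((Finset.univ.filter fun w : Messages F r => w k = b).card : ℝ) =
      Fintype.card (Messages F r) := by
    rw [← Finset.card_univ, Finset.card_eq_sum_card_fiberwise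
      (f := fun w : Messages F r => w k) (t := Finset.univ) (fun _ _ => Finset.mem_univ _)]
    push_cast
    rfl
  have hconst : ∀ b : Fin (r k) → F,
      (Finset.univ.filter fun w : Messages F r => w k = b).card =
        (Finset.univ.filter fun w : Messages F r => w k = a).card := by
    intro b
    -- Translation in coordinate `k` carries one fibre onto another, so all have equal size.
    refine Finset.card_equiv (Equiv.addRight (Pi.single k (a - b))) fun w => ?_
    simp only [Finset.mem_filter, Finset.mem_univ, true_and, Equiv.coe_addRight, Pi.add_apply,
      Pi.single_eq_same]
    constructor
    · rintro rfl; abel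
    · intro h
      have := congrArg (fun v => v - (a - b)) h
      simpa using this
  simp_rw [hconst, Finset.sum_const, Finset.card_univ, nsmul_eq_mul] at hsum
  rw [eq_div_iff (by positivity), ← hsum, mul_comm]
  simp

/-- The success probability is at most the probability of a noise block likelier than `τ`, plus
a volume term. -/
theorem one_sub_errorProb_le (c : Code F n r) (Q : Matrix (Fin 2) (Fin 2) F)
    (P : Fin 2 → PMF F) (k : Fin 2) {τ : ℝ} (hτ : 0 ≤ τ) :
    1 - c.errorProb Q P k ≤
      (∑ z : Fin n → F, if τ < ∏ t, (P k (z t)).toReal then ∏ t, (P k (z t)).toReal else 0) +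
        τ * (Fintype.card F : ℝ) ^ n / (Fintype.card F : ℝ) ^ r k := by
  have hW := card_messages_pos F r
  set p : (Fin n → F) → ℝ := fun z => ∏ t, (P k (z t)).toReal with hp
  have hp0 : ∀ z, 0 ≤ p z := fun z => Finset.prod_nonneg fun _ _ => by positivity
  have hvol : ∑ w : Messages F r, ∑ z : Fin n → F,
      (if c.dec k (c.output Q k w z) = w k then (1 : ℝ) else 0) =
      Fintype.card (Messages F r) *
        ((Fintype.card F : ℝ) ^ n / (Fintype.card F : ℝ) ^ r k) := by
    -- For fixed `w` the noise-to-output map is a translation; each output `y` is then correct for a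
    -- `q ^ (-r k)` fraction of the messages.
    have hw : ∀ w : Messages F r, ∑ z : Fin n → F,
        (if c.dec k (c.output Q k w z) = w k then (1 : ℝ) else 0) =
        ∑ y : Fin n → F, if w k = c.dec k y then (1 : ℝ) else 0 := by
      intro w
      simp only [eq_comm (a := w k)]
      exact Equiv.sum_comp
        (Equiv.addLeft fun t => Q k 0 * c.enc₁ w t + Q k 1 * c.enc₂ (mixed w) t)
        fun y => if c.dec k y = w k then (1 : ℝ) else 0
    simp_rw [hw]
    rw [Finset.sum_comm]
    simp_rw [Finset.sum_boole, card_messages_fiber, Finset.sum_const, Finset.card_univ]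
    simp only [Fintype.card_pi, Finset.prod_const, Finset.card_univ, Fintype.card_fin,
      nsmul_eq_mul, Nat.cast_pow]
    ring
  have hsum : ∑ w : Messages F r, ∑ z : Fin n → F,
      (p z * (1 - if c.dec k (c.output Q k w z) ≠ w k then (1 : ℝ) else 0)) ≤
      ∑ w : Messages F r, ∑ z : Fin n → F, ((if τ < p z then p z else 0) +
        τ * if c.dec k (c.output Q k w z) = w k then (1 : ℝ) else 0) := by
    -- Pointwise, a success of weight `p z` is charged to the tail if `τ < p z`, and otherwise costs
    -- at most `τ`.
    refine Finset.sum_le_sum fun w _ => Finset.sum_le_sum fun z _ => ?_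
    have := hp0 z
    by_cases h1 : c.dec k (c.output Q k w z) = w k
    · simp only [h1, ne_eq, not_true_eq_false, if_false, if_true]
      split_ifs with h2
      · linarith
      · linarith [not_lt.mp h2]
    · simp only [h1, ne_eq, not_false_eq_true, if_true, if_false]
      split_ifs <;> linarith
  simp only [Finset.sum_add_distrib, mul_sub, Finset.sum_sub_distrib, mul_one,
    ← Finset.mul_sum] at hsum
  rw [hvol, sum_prod_toReal] at hsum
  simp only [Finset.sum_const, Finset.card_univ, nsmul_eq_mul, mul_one] at hsum
  have herr : c.errorProb Q P k * Fintype.card (Messages F r) =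
      ∑ w : Messages F r, ∑ z : Fin n → F,
        p z * (if c.dec k (c.output Q k w z) ≠ w k then (1 : ℝ) else 0) := by
    rw [Code.errorProb, div_mul_cancel₀ _ hW.ne']
  rw [← herr] at hsum
  refine le_of_mul_le_mul_left ?_ hW
  calc _ = (Fintype.card (Messages F r) : ℝ) -
        c.errorProb Q P k * Fintype.card (Messages F r) := by ring
    _ ≤ _ := hsum
    _ = _ := by ring

end Codes

/-! ### Converse and sum-rate bound. -/

section Converse

variable {F : Type*} [Field F] [Fintype F] [DecidableEq F]

theorem one_lt_card (F : Type*) [Field F] [Fintype F] : (1 : ℝ) < Fintype.card F := by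
  exact_mod_cast Fintype.one_lt_card

theorem card_pow_eq_two_rpow (F : Type*) [Field F] [Fintype F] (m : ℕ) :
    (Fintype.card F : ℝ) ^ m = 2 ^ (m * Real.logb 2 (Fintype.card F)) := by
  rw [mul_comm, Real.rpow_mul two_pos.le, Real.rpow_logb two_pos (by norm_num)
    (one_pos.trans (one_lt_card F)), Real.rpow_natCast]

/-- Converse to the coding theorem for receiver `k`. -/
theorem eventually_rate_le (Q : Matrix (Fin 2) (Fin 2) F) (P : Fin 2 → PMF F) (k : Fin 2)
    {r : ℕ → Fin 2 → ℕ} (c : (n : ℕ) → Code F n (r n))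
    (hc : Filter.Tendsto (fun n => (c n).errorProb Q P k) Filter.atTop (nhds 0))
    {δ : ℝ} (hδ : 0 < δ) :
    ∀ᶠ n in Filter.atTop, (r n k : ℝ) / (n : ℝ) * Real.logb 2 (Fintype.card F) ≤
      Real.logb 2 (Fintype.card F) - entropy (P k) + δ := by
  obtain ⟨ρ, hρ0, hρ1, hρ⟩ := exists_tail_le_pow (P k) (half_pos hδ)
  have h2 : (2 : ℝ) ^ (-(δ / 2)) < 1 := Real.rpow_lt_one_of_one_lt_of_neg one_lt_two (by linarith)
  -- Error, tail and volume each fall below 1/4, yet they must add up to at least 1.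
  have hquarter : (0 : ℝ) < 1 / 4 := by norm_num
  filter_upwards [hc.eventually_lt_const hquarter,
    (tendsto_pow_atTop_nhds_zero_of_lt_one hρ0 hρ1).eventually_lt_const hquarter,
    (tendsto_pow_atTop_nhds_zero_of_lt_one (Real.rpow_nonneg two_pos.le _) h2).eventually_lt_const
      hquarter, Filter.eventually_gt_atTop 0] with n herr hpow hexp hn
  by_contra! hlt
  have hn' : (0 : ℝ) < n := by exact_mod_cast hn
  rw [div_mul_eq_mul_div, lt_div_iff₀ hn'] at hlt
  -- Half of `δ` in `τ` pays for the tail; the other half leaves a volume term of at most `2 ^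
  -- (-nδ/2)`.
  have hmain := one_sub_errorProb_le (c n) Q P k
    (τ := 2 ^ (-(n * (entropy (P k) - δ / 2)))) (Real.rpow_nonneg two_pos.le _)
  have hvol : (2 : ℝ) ^ (-(n * (entropy (P k) - δ / 2))) * (Fintype.card F : ℝ) ^ n /
      (Fintype.card F : ℝ) ^ r n k ≤ (2 ^ (-(δ / 2))) ^ n := by
    rw [card_pow_eq_two_rpow F n, card_pow_eq_two_rpow F (r n k), ← Real.rpow_add two_pos,
      ← Real.rpow_sub two_pos, ← Real.rpow_natCast, ← Real.rpow_mul two_pos.le]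
    exact Real.rpow_le_rpow_of_exponent_le one_le_two (by linarith)
  linarith [hρ n]

theorem sumRate_le (Q : Matrix (Fin 2) (Fin 2) F) (P : Fin 2 → PMF F)
    (hQ : ∃ k, Q k 0 = 0) {s : ℝ} (hs : s ∈ achievableSumRates Q P) :
    s ≤ Real.logb 2 (Fintype.card F) - min (entropy (P 0)) (entropy (P 1)) := by
  obtain ⟨R, ⟨-, r, c, hrate, herr⟩, rfl⟩ := hs
  obtain ⟨k, hk⟩ := hQ
  refine le_of_forall_pos_le_add fun ε hε => ?_
  -- Two rate slacks and one converse slack. Which message is empty may vary with `n`, but a single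
  -- `n` suffices.
  have hε3 : 0 < ε / 3 := by positivity
  obtain ⟨n, hn0, hn1, hc0, hc1, he⟩ := ((hrate 0 _ hε3).and <| (hrate 1 _ hε3).and <|
    (eventually_rate_le Q P 0 c (herr 0) hε3).and <|
    (eventually_rate_le Q P 1 c (herr 1) hε3).and <|
    (herr k).eventually_lt_const (show (0 : ℝ) < 1 / 2 by norm_num)).exists
  have hzero : r n 0 = 0 ∨ r n 1 = 0 := by
    by_contra! h
    exact he.not_ge (half_le_errorProb (c n) Q P k hk
      (Fin.forall_fin_two.mpr ⟨Nat.pos_of_ne_zero h.1, Nat.pos_of_ne_zero h.2⟩))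
  have hm0 := min_le_left (entropy (P 0)) (entropy (P 1))
  have hm1 := min_le_right (entropy (P 0)) (entropy (P 1))
  rcases hzero with h | h
  · rw [h, Nat.cast_zero, zero_div, zero_mul] at hn0
    linarith
  · rw [h, Nat.cast_zero, zero_div, zero_mul] at hn1
    linarith

/-- Empty messages are never misdecoded. Nonemptiness makes the `sSup` a genuine least upper bound.
-/
theorem zero_mem_achievableSumRates (Q : Matrix (Fin 2) (Fin 2) F) (P : Fin 2 → PMF F) :
    (0 : ℝ) ∈ achievableSumRates Q P := by
  refine ⟨0, ⟨fun _ => le_rfl, fun _ _ => 0, fun n => ⟨0, 0, fun _ _ => 0⟩, ?_, ?_⟩, by simp⟩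
  · intro k ε hε
    exact Filter.Eventually.of_forall fun n => by simpa using hε.le
  · intro k
    have h : ∀ n, (⟨0, 0, fun _ _ => 0⟩ : Code F n fun _ => 0).errorProb Q P k = 0 := by
      intro n
      rw [Code.errorProb, Finset.sum_eq_zero, zero_div]
      intro w _
      refine Finset.sum_eq_zero fun z _ => ?_
      rw [if_neg (not_not.mpr (funext fun i : Fin 0 => i.elim0)), mul_zero]
    simp only [h]
    exact tendsto_const_nhds

end Converse

end NCCIC

open NCCIC in
theorem mainTheorem3 {F : Type*} [Field F] [Fintype F] [DecidableEq F]
    (Q : Matrix (Fin 2) (Fin 2) F) (P : Fin 2 → PMF F)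
    (hP : ∀ k, NCCIC.entropy (P k) < Real.logb 2 (Fintype.card F))
    (hQ : Q 0 0 = 0 ∨ Q 1 0 = 0) :
    IsLUB (NCCIC.achievableSumRates Q P) (NCCIC.sumCapacity Q P) ∧
    NCCIC.sumCapacity Q P ≤
      Real.logb 2 (Fintype.card F) - min (NCCIC.entropy (P 0)) (NCCIC.entropy (P 1)) ∧
    Real.logb 2 (Fintype.card F) - min (NCCIC.entropy (P 0)) (NCCIC.entropy (P 1)) <
      2 * Real.logb 2 (Fintype.card F) - NCCIC.entropy (P 0) - NCCIC.entropy (P 1) ∧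
    (∀ k, NCCIC.additiveNoiseCapacity (P k) =
      Real.logb 2 (Fintype.card F) - NCCIC.entropy (P k)) ∧
    NCCIC.sumCapacity Q P <
      NCCIC.additiveNoiseCapacity (P 0) + NCCIC.additiveNoiseCapacity (P 1) := by
  have hne : (achievableSumRates Q P).Nonempty := ⟨0, zero_mem_achievableSumRates Q P⟩
  have hbd : ∀ s ∈ achievableSumRates Q P,
      s ≤ Real.logb 2 (Fintype.card F) - min (entropy (P 0)) (entropy (P 1)) :=
    fun s hs => sumRate_le Q P (Fin.exists_fin_two.mpr hQ) hs
  have hle : sumCapacity Q P ≤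
      Real.logb 2 (Fintype.card F) - min (entropy (P 0)) (entropy (P 1)) := csSup_le hne hbd
  have hlt : Real.logb 2 (Fintype.card F) - min (entropy (P 0)) (entropy (P 1)) <
      2 * Real.logb 2 (Fintype.card F) - entropy (P 0) - entropy (P 1) := by
    -- The gap is `log q` minus the entropy not chosen by the minimum.
    rcases min_choice (entropy (P 0)) (entropy (P 1)) with h | h <;> rw [h]
    · linarith [hP 1]
    · linarith [hP 0]
  refine ⟨isLUB_csSup hne ⟨_, hbd⟩, hle, hlt, fun k => additiveNoiseCapacity_eq (P k), ?_⟩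
  rw [additiveNoiseCapacity_eq, additiveNoiseCapacity_eq]
  linarith
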